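/- Let $(l_i)_{i\ge 0}$ be a sequence of pairwise coprime integers $l_i\ge 7$ (for example, pairwise distinct primes $\ge 7$), and for $n\ge 0$ let $T_n$ be the infinite rooted tree whose vertices are the finite words $x_nx_{n+1}\cdots x_{n+k-1}$ ($k\ge 0$) with $x_i\in\{1,\dots,l_i\}$, each word being joined to the words obtained from it by appending one letter; the root is the empty word. Let $a_n\in\operatorname{Aut}(T_n)$ be the rooted automorphism that permutes the first letter by the $l_n$-cycle $(1\,2\,\cdots\,l_n)$ and leaves the other letters unchanged, and define $b_n\in \operatorname{Aut}(T_n)$ recursively by \[ b_n=(b_{n+1},a_{n+1},1,\dots,1), \] that is, $b_n$ fixes the first level of $T_n$, acts as $b_{n+1}$ on the subtree below the first vertex of level $1$, as $a_{n+1}$ on the subtree below the second one, and trivially on all the others. Let $G=\langle a_0,b_0\rangle\le\operatorname{Aut}(T_0)$. Suppose that \[ l_i\ \ge\ (25\,l_{i-1})^{3m_i}\quad\text{for all } i\ge 1,\qquad\text{where } m_i=\prod_{j=0}^{i-1}l_j . \] Then $G$ has no free subgroup of rank $2$. Indeed, for all $g_1,g_2\in G$ there is a non-trivial element $w$ of the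 free group of rank $2$ such that $w(g_1,g_2)=1$. -/

import Mathlib

/-- Vertices of the spherically homogeneous rooted tree `T_n` with defining sequence
`l n, l (n+1), …`.  A vertex is a finite word whose successive letters lie in the alphabets
`ZMod (l n)`, `ZMod (l (n+1))`, …; the letter `j` stands for the `(j+1)`-st vertex. -/
inductive Vertex (l : ℕ → ℕ) : ℕ → Type
  | root (n : ℕ) : Vertex l n
  | cons {n : ℕ} (x : ZMod (l n)) (v : Vertex l (n + 1)) : Vertex l n

/-- `IsChild u v`: the word `v` is obtained from the word `u` by appending one letter. -/
inductive IsChild (l : ℕ → ℕ) : ∀ n : ℕ, Vertex l n → Vertex l n → Prop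
  | root {n : ℕ} (x : ZMod (l n)) :
      IsChild l n (Vertex.root n) (Vertex.cons x (Vertex.root (n + 1)))
  | cons {n : ℕ} (x : ZMod (l n)) {u v : Vertex l (n + 1)} (h : IsChild l (n + 1) u v) :
      IsChild l n (Vertex.cons x u) (Vertex.cons x v)

/-- The rooted tree `T_n` as a graph: each vertex is joined to its children. -/
def rootedTree (l : ℕ → ℕ) (n : ℕ) : SimpleGraph (Vertex l n) :=
  SimpleGraph.fromRel (IsChild l n)

/-- `Aut T_n`: the bijections of the vertex set that preserve adjacency and fix the root. -/
def treeAut (l : ℕ → ℕ) (n : ℕ) : Subgroup (Equiv.Perm (Vertex l n)) where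
  carrier := {f | f (Vertex.root n) = Vertex.root n ∧
    ∀ u v, (rootedTree l n).Adj (f u) (f v) ↔ (rootedTree l n).Adj u v}
  one_mem' := ⟨rfl, fun _ _ => Iff.rfl⟩
  mul_mem' := by
    rintro f g ⟨hf, hf'⟩ ⟨hg, hg'⟩
    refine ⟨?_, fun u v => ?_⟩
    · rw [Equiv.Perm.mul_apply, hg, hf]
    · rw [Equiv.Perm.mul_apply, Equiv.Perm.mul_apply, hf', hg']
  inv_mem' := by
    rintro f ⟨hf, hf'⟩
    refine ⟨?_, fun u v => ?_⟩
    · rw [Equiv.Perm.inv_eq_iff_eq, hf]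
    · rw [← hf' (f⁻¹ u) (f⁻¹ v)]; simp

/-- A permutation of the vertices that fixes the root and, together with its inverse,
preserves the child relation is a tree automorphism. -/
theorem mem_treeAut_of_isChild {l : ℕ → ℕ} {n : ℕ} (f : Equiv.Perm (Vertex l n))
    (hr : f (Vertex.root n) = Vertex.root n)
    (h₁ : ∀ u v, IsChild l n u v → IsChild l n (f u) (f v))
    (h₂ : ∀ u v, IsChild l n u v → IsChild l n (f.symm u) (f.symm v)) :
    f ∈ treeAut l n := by
  have h : ∀ u v, IsChild l n (f u) (f v) ↔ IsChild l n u v := fun u v =>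
    ⟨fun k => by simpa using h₂ _ _ k, h₁ u v⟩
  exact ⟨hr, fun u v => by simp [rootedTree, SimpleGraph.fromRel_adj, h]⟩

/-- Add `t` to the first letter of a word, i.e. permute the vertices of level `1`
(with the subtrees below them) cyclically. -/
def rotateFun (l : ℕ → ℕ) (n : ℕ) (t : ZMod (l n)) : Vertex l n → Vertex l n
  | Vertex.root _ => Vertex.root n
  | Vertex.cons x v => Vertex.cons (x + t) v

theorem rotateFun_isChild (l : ℕ → ℕ) (n : ℕ) (t : ZMod (l n)) (u v : Vertex l n)
    (h : IsChild l n u v) : IsChild l n (rotateFun l n t u) (rotateFun l n t v) := by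
  cases h with
  | root x => exact IsChild.root _
  | cons x h => exact IsChild.cons _ h

/-- The generator `a_n` of the cyclic group `A_n` of order `l n`, as a permutation of the
vertices of `T_n`: it moves the `j`-th vertex of level `1` to the `(j+1)`-st one, cyclically. -/
def rootedPerm (l : ℕ → ℕ) (n : ℕ) : Equiv.Perm (Vertex l n) where
  toFun := rotateFun l n 1
  invFun := rotateFun l n (-1)
  left_inv v := by cases v <;> simp [rotateFun]
  right_inv v := by cases v <;> simp [rotateFun]

/-- The rooted automorphism `a_n` of `T_n`. -/
def genA (l : ℕ → ℕ) (n : ℕ) : treeAut l n :=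
  ⟨rootedPerm l n, mem_treeAut_of_isChild _ rfl (rotateFun_isChild l n 1)
    (rotateFun_isChild l n (-1))⟩

/-- The map that fixes level `1` of `T_n`, acts recursively below the first vertex, adds `e`
to the next letter below the second vertex, and is trivial below all others. -/
def spinalFun (l : ℕ → ℕ) (e : ℤ) : ∀ n : ℕ, Vertex l n → Vertex l n
  | n, Vertex.root _ => Vertex.root n
  | n, Vertex.cons x v =>
      if x = 0 then Vertex.cons x (spinalFun l e (n + 1) v)
      else if x = 1 then Vertex.cons x (rotateFun l (n + 1) (e : ZMod (l (n + 1))) v)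
      else Vertex.cons x v

theorem rotateFun_rotateFun_neg (l : ℕ → ℕ) (n : ℕ) (t : ZMod (l n)) (v : Vertex l n) :
    rotateFun l n (-t) (rotateFun l n t v) = v := by
  cases v <;> simp [rotateFun]

theorem spinalFun_spinalFun_neg (l : ℕ → ℕ) (e : ℤ) (n : ℕ) (v : Vertex l n) :
    spinalFun l (-e) n (spinalFun l e n v) = v := by
  induction v with
  | root n => simp [spinalFun]
  | @cons n x v ih =>
    by_cases h0 : x = 0
    · simp [spinalFun, h0, ih]
    · by_cases h1 : x = 1
      · have h10 : (1 : ZMod (l n)) ≠ 0 := h1 ▸ h0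
        simp [spinalFun, h1, h10, rotateFun_rotateFun_neg]
      · simp [spinalFun, h0, h1]

theorem spinalFun_isChild (l : ℕ → ℕ) (e : ℤ) (n : ℕ) (u v : Vertex l n)
    (h : IsChild l n u v) : IsChild l n (spinalFun l e n u) (spinalFun l e n v) := by
  induction h with
  | @root n x =>
    simp only [spinalFun, rotateFun]
    split_ifs <;> exact IsChild.root _
  | @cons n x u v h ih =>
    simp only [spinalFun]
    split_ifs
    · exact IsChild.cons _ ih
    · exact IsChild.cons _ (rotateFun_isChild l _ _ _ _ h)
    · exact IsChild.cons _ h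

/-- The recursively defined `b_n = (b_{n+1}, a_{n+1}, 1, …, 1)` as a permutation of the
vertices of `T_n`. -/
def spinalPerm (l : ℕ → ℕ) (n : ℕ) : Equiv.Perm (Vertex l n) where
  toFun := spinalFun l 1 n
  invFun := spinalFun l (-1) n
  left_inv v := spinalFun_spinalFun_neg l 1 n v
  right_inv v := by simpa using spinalFun_spinalFun_neg l (-1) n v

/-- The automorphism `b_n = (b_{n+1}, a_{n+1}, 1, …, 1)` of `T_n`. -/
def genB (l : ℕ → ℕ) (n : ℕ) : treeAut l n :=
  ⟨spinalPerm l n, mem_treeAut_of_isChild _ (by simp [spinalPerm, spinalFun])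
    (spinalFun_isChild l 1 n) (spinalFun_isChild l (-1) n)⟩

/-- The group `G = ⟨a_0, b_0⟩` of automorphisms of the rooted tree with defining sequence
`l 0, l 1, …`. -/
def spinalGroup (l : ℕ → ℕ) : Subgroup (treeAut l 0) :=
  Subgroup.closure {genA l 0, genB l 0}

/-! Let `φ` be the homomorphism from the free group `F` of rank 2 given by the two elements. Deep
enough in the tree, all sections of the generators are powers of `a_n` or `b_n` with exponents
bounded by a constant `L` not depending on `n` (`exists_smallSections`). A word of length `k` then
shifts the letter following a vertex of level `n` by at most `kL`, and its nontrivial sections one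
level lower sit at letters within `kL + 1` of `0` (`Spread`). If `l n` is huge, this is a short
interval of a long cycle.

Let `m` be the number of vertices of level `n`. A short word `w ≠ 1` is chosen that fixes level `n +
1` and has trivial sections wherever the sections of the image of `φ` commute
(`exists_ne_one_commutator_trivial`). The vertices `p` of level `n` are then treated one by one. By
`exists_moves_child_or_commute`, either all sections below `p` are already trivial, or the
stabilizer of `p` moves a child of `p`. In the second case a short word does so too
(`exists_spread_loop`). One of its powers, adjusted to a word `t`, translates the interval off
itself, and `⁅w, t * w * t⁻¹⁆` has trivial sections below `p` while keeping those already killed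
(`exists_commutator_sec_eq_one`).

The word stays nontrivial in `F`, since `w` commutes with `t * w * t⁻¹` only if it commutes with
`t`. Each step multiplies the spread bound by at most `56mL`, so `(56mL)^(m+1) ≤ l n` is enough, and
the growth condition provides such `n` arbitrarily far down. -/

/-! ### Centralizers in free groups. -/

/-- A free group on at least two generators has trivial centre. -/
theorem FreeGroup.subsingleton_of_forall_commute {ι : Type*} {w : FreeGroup ι}
    (hw : ∀ s, Commute (FreeGroup.of s) w) (hw1 : w ≠ 1) : Subsingleton ι := by
  classical
  refine ⟨fun i₀ j₀ => ?_⟩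
  by_contra hij
  obtain ⟨⟨i, b⟩, L, hL⟩ : ∃ a L, w.toWord = a :: L :=
    List.exists_cons_of_ne_nil (fun h => hw1 (FreeGroup.toWord_eq_nil_iff.1 h))
  obtain ⟨j, hj⟩ : ∃ j, j ≠ i := by
    by_cases h : i₀ = i
    · exact ⟨j₀, fun h' => hij (h.trans h'.symm)⟩
    · exact ⟨i₀, h⟩
  have hred : FreeGroup.IsReduced w.toWord := FreeGroup.isReduced_toWord
  -- As `j` differs from the first generator of `w`, nothing cancels on the left. Hence nothing
  -- cancels in `w * of j` either, by length, and the two words differ in their first letter.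
  have h1 : (FreeGroup.of j * w).toWord = (j, true) :: w.toWord := by
    rw [FreeGroup.toWord_mul, FreeGroup.toWord_of]
    apply FreeGroup.IsReduced.reduce_eq
    rw [hL] at hred ⊢
    simp only [List.singleton_append]
    refine List.isChain_cons_cons.2 ⟨?_, hred⟩
    intro h
    exact absurd h hj
  have h2 := FreeGroup.toWord_mul_sublist w (FreeGroup.of j)
  rw [← (hw j).eq, h1, FreeGroup.toWord_of] at h2
  have h3 := h2.eq_of_length (by simp)
  rw [hL] at h3
  simp at h3
  exact hj h3.1.1

/-- A free group with a nontrivial central element is cyclic. -/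
theorem IsFreeGroup.isCyclic_of_central {G : Type*} [Group G] [IsFreeGroup G] {w : G}
    (hw : ∀ g, Commute g w) (hw1 : w ≠ 1) : IsCyclic G := by
  let e := IsFreeGroup.toFreeGroup G
  have hs : Subsingleton (IsFreeGroup.Generators G) := by
    refine FreeGroup.subsingleton_of_forall_commute (w := e w) (fun s => ?_) (by simpa using hw1)
    have := (hw (e.symm (FreeGroup.of s))).map e
    simpa using this
  have : IsCyclic (FreeGroup (IsFreeGroup.Generators G)) := by
    rcases isEmpty_or_nonempty (IsFreeGroup.Generators G) with h | ⟨⟨x⟩⟩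
    · exact isCyclic_of_subsingleton
    · let _ : Unique (IsFreeGroup.Generators G) := ⟨⟨x⟩, fun y => Subsingleton.elim _ _⟩
      exact (FreeGroup.mulEquivIntOfUnique (α := IsFreeGroup.Generators G)).isCyclic.2 inferInstance
  exact e.isCyclic.2 this

/-- The elements commuting with a nontrivial element of a free group are powers of one element. -/
theorem IsFreeGroup.exists_commute_iff {G : Type*} [Group G] [IsFreeGroup G] {w : G}
    (hw : w ≠ 1) : ∃ c : G, ∀ g, Commute w g ↔ ∃ k : ℤ, c ^ k = g := by
  have hmem : w ∈ Subgroup.centralizer {w} := by simp [Subgroup.mem_centralizer_iff]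
  -- The centralizer is itself free by Nielsen–Schreier, and `w` is central in it.
  obtain ⟨c, hc⟩ := IsFreeGroup.isCyclic_of_central (G := Subgroup.centralizer {w})
    (w := ⟨w, hmem⟩) (fun g => Subtype.ext (Subgroup.mem_centralizer_iff.1 g.2 w rfl).symm)
    (fun h => hw (congrArg Subtype.val h))
  refine ⟨c, fun g => ⟨fun h => ?_, ?_⟩⟩
  · obtain ⟨k, hk⟩ := hc ⟨g, by
      rw [Subgroup.mem_centralizer_iff]; rintro _ rfl; exact h⟩
    exact ⟨k, by simpa using congrArg Subtype.val hk⟩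
  · rintro ⟨k, rfl⟩
    have : Commute w c := Subgroup.mem_centralizer_iff.1 c.2 w rfl
    exact this.zpow_right k

/-- Both elements lie in the centralizer of `w`, which is cyclic. -/
theorem IsFreeGroup.commute_trans {G : Type*} [Group G] [IsFreeGroup G] {w g h : G}
    (hw : w ≠ 1) (hg : Commute w g) (hh : Commute w h) : Commute g h := by
  obtain ⟨c, hc⟩ := IsFreeGroup.exists_commute_iff hw
  obtain ⟨i, rfl⟩ := (hc g).1 hg
  obtain ⟨j, rfl⟩ := (hc h).1 hh
  exact (Commute.refl c).zpow_zpow i j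

/-- In a free group, if `w` commutes with a conjugate `u w u⁻¹`, then it commutes with `u`. -/
theorem FreeGroup.commute_of_commute_conj {α : Type*} {w u : FreeGroup α}
    (h : Commute w (u * w * u⁻¹)) : Commute w u := by
  rcases eq_or_ne w 1 with rfl | hw
  · exact Commute.one_left u
  obtain ⟨c, hc⟩ := IsFreeGroup.exists_commute_iff hw
  have hwc : Commute w c := (hc c).2 ⟨1, zpow_one c⟩
  have hw' : u * w * u⁻¹ ≠ 1 := by simpa using hw
  -- `w` and its conjugate have the same centralizer `⟨c⟩`, so conjugation by `u` preserves `⟨c⟩`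
  -- and sends `c` to `c` or `c⁻¹`.
  have h1 : ∀ g, Commute w g ↔ Commute (u * w * u⁻¹) g := fun g =>
    ⟨fun hg => IsFreeGroup.commute_trans hw h hg,
      fun hg => IsFreeGroup.commute_trans hw' h.symm hg⟩
  have hconj : ∀ a b v : FreeGroup α, Commute (v * a * v⁻¹) b ↔ Commute a (v⁻¹ * b * v) := by
    intro a b v
    have := SemiconjBy.conj_iff (a := a) (x := v⁻¹ * b * v) (y := v⁻¹ * b * v) (b := v)
    simp only [mul_assoc, mul_inv_cancel, mul_one, mul_inv_cancel_left] at this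
    simpa only [Commute, mul_assoc] using this
  obtain ⟨k, hk⟩ := (hc (u⁻¹ * c * u)).1 ((hconj _ _ _).1 ((h1 c).1 hwc))
  obtain ⟨j, hj⟩ := (hc (u * c * u⁻¹)).1 ((h1 _).2 ((hconj _ _ _).2 (by
    simpa [mul_assoc] using hwc)))
  have hc1 : c ≠ 1 := by
    rintro rfl
    obtain ⟨k, hk⟩ := (hc w).1 (Commute.refl w)
    exact hw (by simpa using hk.symm)
  have hkj : c ^ (j * k) = c ^ (1 : ℤ) := by
    rw [zpow_mul, hj, conj_zpow, hk]; group
  have hjk : j * k = 1 := injective_zpow_iff_not_isOfFinOrder.2 (not_isOfFinOrder_of_isMulTorsionFree hc1) hkj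
  obtain ⟨i, rfl⟩ := (hc w).1 (Commute.refl w)
  have huc : u * c * u⁻¹ = c → Commute u c := fun h => by
    rw [mul_inv_eq_iff_eq_mul] at h; exact h
  rcases Int.eq_one_or_neg_one_of_mul_eq_one hjk with rfl | rfl
  · exact ((huc (by simpa using hj.symm)).zpow_right i).symm
  -- Inversion cannot really occur unless trivially: `u * u` commutes with both `u` and `c`, so
  -- transitivity applies.
  · have hj' : u * c * u⁻¹ = c⁻¹ := by simpa using hj.symm
    have h2 : Commute (u * u) c := by
      have : u * (u * c * u⁻¹) * u⁻¹ = c := by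
        rw [hj']
        have := congrArg (·⁻¹) hj'
        simpa [mul_assoc] using this
      rw [Commute, SemiconjBy]
      nth_rewrite 2 [← this]
      group
    rcases eq_or_ne u 1 with rfl | hu
    · exact Commute.one_right _
    · have hu2 : u * u ≠ 1 := by
        rw [← pow_two]; exact fun h => hu (by simpa using h)
      exact ((IsFreeGroup.commute_trans hu2 ((Commute.refl u).mul_left (Commute.refl u))
        h2).zpow_right i).symm

theorem FreeGroup.not_commute_of_pow {i j : ℕ} (hi : i ≠ 0) (hj : j ≠ 0) :
    ¬ Commute ((FreeGroup.of 0 : FreeGroup (Fin 2)) ^ i) (FreeGroup.of 1 ^ j) := by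
  intro h
  have h0 : (FreeGroup.of 0 : FreeGroup (Fin 2)) ^ i ≠ 1 := by simp [hi, pow_eq_one_iff]
  have h1 : (FreeGroup.of 1 : FreeGroup (Fin 2)) ^ j ≠ 1 := by simp [hj, pow_eq_one_iff]
  have h2 := IsFreeGroup.commute_trans h1 h.symm ((Commute.refl _).pow_left j)
  have h3 := IsFreeGroup.commute_trans h0 ((Commute.refl _).pow_left i) h2
  have := congrArg FreeGroup.toWord h3.eq
  revert this
  decide

/-! ### Words of fixed length, growing at the end. -/

/-- Vertices of level `n` of `T_0`, as words built by appending letters at the end. -/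
inductive LevelPath (l : ℕ → ℕ) : ℕ → Type
  | nil : LevelPath l 0
  | snoc {n : ℕ} (p : LevelPath l n) (x : ZMod (l n)) : LevelPath l (n + 1)

namespace LevelPath

variable {l : ℕ → ℕ}

/-- The concatenation of a word of length `n` with a vertex of `T_n`. -/
def attach : ∀ {n : ℕ}, LevelPath l n → Vertex l n → Vertex l 0
  | _, nil, v => v
  | _, snoc p x, v => attach p (Vertex.cons x v)

@[simp] theorem attach_nil (v : Vertex l 0) : attach nil v = v := rfl

@[simp] theorem attach_snoc {n : ℕ} (p : LevelPath l n) (x : ZMod (l n)) (v : Vertex l (n + 1)) :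
    attach (snoc p x) v = attach p (Vertex.cons x v) := rfl

theorem attach_inj {n : ℕ} {p q : LevelPath l n} {v w : Vertex l n}
    (h : attach p v = attach q w) : p = q ∧ v = w := by
  induction p with
  | nil => cases q; exact ⟨rfl, h⟩
  | snoc p x ih =>
    cases q with
    | snoc q y =>
      obtain ⟨rfl, h'⟩ := ih h
      cases h'
      exact ⟨rfl, rfl⟩

/-- Words of length `n + 1` are words of length `n` with one more letter. -/
def snocEquiv (l : ℕ → ℕ) (n : ℕ) : LevelPath l n × ZMod (l n) ≃ LevelPath l (n + 1) where
  toFun a := snoc a.1 a.2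
  invFun p := match p with
    | snoc p x => (p, x)
  left_inv _ := rfl
  right_inv p := by cases p; rfl

/-- There is exactly one word of length `0`. -/
def nilEquiv (l : ℕ → ℕ) : Unit ≃ LevelPath l 0 where
  toFun _ := nil
  invFun _ := ()
  left_inv _ := rfl
  right_inv p := by cases p; rfl

theorem finite (hl : ∀ i, l i ≠ 0) (n : ℕ) : Finite (LevelPath l n) := by
  induction n with
  | zero => exact Finite.of_equiv _ (nilEquiv l)
  | succ n ih =>
    have : NeZero (l n) := ⟨hl n⟩
    exact Finite.of_equiv _ (snocEquiv l n)

theorem card (n : ℕ) : Nat.card (LevelPath l n) = ∏ j ∈ Finset.range n, l j := by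
  induction n with
  | zero => rw [← Nat.card_congr (nilEquiv l)]; simp
  | succ n ih =>
    rw [← Nat.card_congr (snocEquiv l n), Nat.card_prod, ih, Nat.card_zmod,
      Finset.prod_range_succ]

end LevelPath

/-! ### Sections of automorphisms and their contraction to powers of generators. -/

section Sections

open LevelPath

variable {l : ℕ → ℕ}

/-- `g` maps the subtree below `p` to the subtree below `q`, acting as `h`. -/
def HasSection {n : ℕ} (g : treeAut l 0) (p q : LevelPath l n) (h : treeAut l n) : Prop :=
  ∀ v, g.1 (p.attach v) = q.attach (h.1 v)

namespace HasSection

variable {n : ℕ} {g g' : treeAut l 0} {p q r : LevelPath l n} {h h' : treeAut l n}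

theorem one (p : LevelPath l n) : HasSection 1 p p 1 := fun _ => rfl

theorem mul (H' : HasSection g' q r h') (H : HasSection g p q h) :
    HasSection (g' * g) p r (h' * h) := fun v => by
  change g'.1 (g.1 _) = r.attach (h'.1 (h.1 v))
  rw [H, H']

theorem unique (H : HasSection g p q h) (H' : HasSection g p r h') : q = r ∧ h = h' := by
  have h1 : ∀ v, q = r ∧ h.1 v = h'.1 v := fun v =>
    attach_inj ((H v).symm.trans (H' v))
  exact ⟨(h1 (Vertex.root n)).1, Subtype.ext (Equiv.ext fun v => (h1 v).2)⟩

end HasSection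

/-- The automorphisms `g` such that `g` and `g⁻¹` have a section at every vertex. -/
def sectionGroup (l : ℕ → ℕ) : Subgroup (treeAut l 0) where
  carrier := {g | (∀ n (p : LevelPath l n), ∃ q h, HasSection g p q h) ∧
    ∀ n (p : LevelPath l n), ∃ q h, HasSection g⁻¹ p q h}
  one_mem' := ⟨fun _ p => ⟨p, 1, HasSection.one p⟩,
    fun _ p => ⟨p, 1, by rw [inv_one]; exact HasSection.one p⟩⟩
  mul_mem' := by
    rintro a b ⟨ha, ha'⟩ ⟨hb, hb'⟩
    refine ⟨fun n p => ?_, fun n p => ?_⟩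
    · obtain ⟨q, h, H⟩ := hb n p
      obtain ⟨r, h', H'⟩ := ha n q
      exact ⟨r, _, H'.mul H⟩
    · obtain ⟨q, h, H⟩ := ha' n p
      obtain ⟨r, h', H'⟩ := hb' n q
      exact ⟨r, _, by rw [mul_inv_rev]; exact H'.mul H⟩
  inv_mem' := by
    rintro a ⟨ha, ha'⟩
    exact ⟨ha', by simpa using ha⟩

theorem exists_hasSection {n : ℕ} (g : sectionGroup l) (p : LevelPath l n) :
    ∃ a : LevelPath l n × treeAut l n, HasSection g.1 p a.1 a.2 := by
  obtain ⟨q, h, H⟩ := g.2.1 n p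
  exact ⟨(q, h), H⟩

/-- The action of `sectionGroup` on the vertices of level `n`. -/
noncomputable instance {n : ℕ} : SMul (sectionGroup l) (LevelPath l n) :=
  ⟨fun g p => (exists_hasSection g p).choose.1⟩

/-- The section of `g` at the vertex `p`. -/
noncomputable def sec {n : ℕ} (g : sectionGroup l) (p : LevelPath l n) : treeAut l n :=
  (exists_hasSection g p).choose.2

theorem hasSection_sec {n : ℕ} (g : sectionGroup l) (p : LevelPath l n) :
    HasSection g.1 p (g • p) (sec g p) :=
  (exists_hasSection g p).choose_spec

theorem smul_eq_and_sec_eq {n : ℕ} {g : sectionGroup l} {p q : LevelPath l n} {h : treeAut l n}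
    (H : HasSection g.1 p q h) : g • p = q ∧ sec g p = h :=
  (hasSection_sec g p).unique H

noncomputable instance {n : ℕ} : MulAction (sectionGroup l) (LevelPath l n) where
  one_smul p := (smul_eq_and_sec_eq (HasSection.one p)).1
  mul_smul g h p := (smul_eq_and_sec_eq ((hasSection_sec g (h • p)).mul (hasSection_sec h p))).1

theorem sec_one {n : ℕ} (p : LevelPath l n) : sec (1 : sectionGroup l) p = 1 :=
  (smul_eq_and_sec_eq (HasSection.one p)).2

theorem sec_mul {n : ℕ} (g h : sectionGroup l) (p : LevelPath l n) :
    sec (g * h) p = sec g (h • p) * sec h p :=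
  (smul_eq_and_sec_eq ((hasSection_sec g (h • p)).mul (hasSection_sec h p))).2

theorem sec_inv {n : ℕ} (g : sectionGroup l) (p : LevelPath l n) :
    sec g⁻¹ p = (sec g (g⁻¹ • p))⁻¹ := by
  have := sec_mul g g⁻¹ p
  rw [mul_inv_cancel, sec_one] at this
  exact (inv_eq_of_mul_eq_one_right this.symm).symm

/-- An element that fixes every vertex of level `n` and has trivial sections there is trivial. -/
theorem eq_one_of_forall_sec {g : sectionGroup l} (n : ℕ)
    (h1 : ∀ p : LevelPath l n, g • p = p) (h2 : ∀ p : LevelPath l n, sec g p = 1) : g = 1 := by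
  have key : ∀ n, (∀ p : LevelPath l n, g • p = p) → (∀ p : LevelPath l n, sec g p = 1) →
      ∀ v : Vertex l 0, g.1.1 v = v := by
    intro n h1 h2 v
    have h3 : ∀ p : LevelPath l n, ∀ w, g.1.1 (p.attach w) = p.attach w := fun p w => by
      have := hasSection_sec g p w
      rw [this, h1, h2]; rfl
    clear h1 h2
    induction n with
    | zero => exact h3 nil v
    | succ n ih =>
      refine ih fun p w => ?_
      cases w with
      | cons x w => exact h3 (snoc p x) w
      -- The vertex `p` itself lies below none of its children. It is fixed because it is the parent
      -- of the fixed vertex `snoc p 0`.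
      | root =>
        have h4 := hasSection_sec g p (Vertex.root n)
        rw [(sec g p).2.1] at h4
        rw [h4]
        have h5 := hasSection_sec g p (Vertex.cons 0 (Vertex.root (n + 1)))
        have h6 := h3 (snoc p 0) (Vertex.root (n + 1))
        rw [attach_snoc] at h6
        rw [h6] at h5
        rw [← (attach_inj h5).1]
  exact Subtype.ext (Subtype.ext (Equiv.ext (key n h1 h2)))

theorem genA_zpow_apply_cons {n : ℕ} (i : ℤ) (x : ZMod (l n)) (v : Vertex l (n + 1)) :
    ((genA l n) ^ i).1 (Vertex.cons x v) = Vertex.cons (x + (i : ZMod (l n))) v := by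
  induction i generalizing x with
  | zero => simp
  | succ i ih =>
    rw [zpow_add_one]
    change ((genA l n) ^ (i : ℤ)).1 (Vertex.cons (x + 1) v) = _
    rw [ih]; push_cast; congr 1; ring
  | pred i ih =>
    rw [zpow_sub_one]
    change ((genA l n) ^ (-i : ℤ)).1 (Vertex.cons (x + -1) v) = _
    rw [ih]; push_cast; congr 1; ring

theorem genB_zpow_apply_cons {n : ℕ} (i : ℤ) (x : ZMod (l n))
    (v : Vertex l (n + 1)) :
    ((genB l n) ^ i).1 (Vertex.cons x v) =
      Vertex.cons x (if x = 0 then (genB l (n + 1) ^ i).1 v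
        else if x = 1 then (genA l (n + 1) ^ i).1 v else v) := by
  have hB : ∀ v, (genB l n).1 (Vertex.cons x v) = Vertex.cons x
      (if x = 0 then (genB l (n + 1)).1 v else if x = 1 then (genA l (n + 1)).1 v else v) := by
    intro v
    change spinalFun l 1 n _ = _
    rw [spinalFun]
    split_ifs
    · rfl
    · change _ = Vertex.cons x (rotateFun l (n + 1) 1 v)
      simp
    · rfl
  have hB' : ∀ v, (genB l n)⁻¹.1 (Vertex.cons x v) = Vertex.cons x
      (if x = 0 then (genB l (n + 1))⁻¹.1 v
        else if x = 1 then (genA l (n + 1))⁻¹.1 v else v) := by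
    intro v
    change (genB l n).1⁻¹ _ = _
    rw [Equiv.Perm.inv_eq_iff_eq, hB]
    split_ifs
    · change _ = Vertex.cons x ((genB l (n + 1)).1 ((genB l (n + 1)).1⁻¹ v)); simp
    · change _ = Vertex.cons x ((genA l (n + 1)).1 ((genA l (n + 1)).1⁻¹ v)); simp
    · rfl
  induction i generalizing v with
  | zero => simp
  | succ i ih =>
    rw [zpow_add_one, zpow_add_one, zpow_add_one]
    change ((genB l n) ^ (i : ℤ)).1 ((genB l n).1 _) = _
    rw [hB, ih]
    split_ifs <;> rfl
  | pred i ih =>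
    rw [zpow_sub_one, zpow_sub_one, zpow_sub_one]
    change ((genB l n) ^ (-i : ℤ)).1 ((genB l n)⁻¹.1 _) = _
    rw [hB', ih]
    split_ifs <;> rfl

theorem HasSection.snoc_genA {n : ℕ} {g : treeAut l 0} {p q : LevelPath l n} {i : ℤ}
    (H : HasSection g p q (genA l n ^ i)) (x : ZMod (l n)) :
    HasSection g (snoc p x) (snoc q (x + i)) 1 := fun v => by
  rw [attach_snoc, H, genA_zpow_apply_cons]; rfl

theorem HasSection.snoc_genB {n : ℕ} {g : treeAut l 0} {p q : LevelPath l n} {i : ℤ}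
    (H : HasSection g p q (genB l n ^ i)) (x : ZMod (l n)) :
    HasSection g (snoc p x) (snoc q x) (if x = 0 then genB l (n + 1) ^ i
      else if x = 1 then genA l (n + 1) ^ i else 1) := fun v => by
  rw [attach_snoc, H, genB_zpow_apply_cons, attach_snoc]
  split_ifs <;> rfl

/-- Sections of powers of `a_n` and `b_n` are again such powers. Allowing all exponents makes the
hypothesis stable under inversion. -/
theorem mem_sectionGroup_of_eq_zpow {g : treeAut l 0}
    (h : ∃ i : ℤ, g = genA l 0 ^ i ∨ g = genB l 0 ^ i) : g ∈ sectionGroup l := by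
  have key : ∀ g : treeAut l 0, (∃ i : ℤ, g = genA l 0 ^ i ∨ g = genB l 0 ^ i) →
      ∀ n (p : LevelPath l n), ∃ q, ∃ i : ℤ,
        HasSection g p q (genA l n ^ i) ∨ HasSection g p q (genB l n ^ i) := by
    intro g hg n p
    induction p with
    | nil =>
      obtain ⟨i, rfl | rfl⟩ := hg
      · exact ⟨nil, i, Or.inl fun v => rfl⟩
      · exact ⟨nil, i, Or.inr fun v => rfl⟩
    | @snoc n p x ih =>
      obtain ⟨q, i, H | H⟩ := ih
      · exact ⟨_, 0, Or.inl (H.snoc_genA x)⟩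
      · have H' := H.snoc_genB x
        split_ifs at H'
        · exact ⟨_, i, Or.inr H'⟩
        · exact ⟨_, i, Or.inl H'⟩
        · exact ⟨_, 0, Or.inl H'⟩
  have key' : ∀ g : treeAut l 0, (∃ i : ℤ, g = genA l 0 ^ i ∨ g = genB l 0 ^ i) →
      ∀ n (p : LevelPath l n), ∃ q h, HasSection g p q h := by
    intro g hg n p
    obtain ⟨q, i, H | H⟩ := key g hg n p
    · exact ⟨q, _, H⟩
    · exact ⟨q, _, H⟩
  refine ⟨key' g h, key' _ ?_⟩
  obtain ⟨i, rfl | rfl⟩ := h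
  · exact ⟨-i, Or.inl (by simp)⟩
  · exact ⟨-i, Or.inr (by simp)⟩

theorem spinalGroup_le_sectionGroup : spinalGroup l ≤ sectionGroup l := by
  rw [spinalGroup, Subgroup.closure_le]
  rintro g (rfl | rfl)
  · exact mem_sectionGroup_of_eq_zpow ⟨1, Or.inl (by simp)⟩
  · exact mem_sectionGroup_of_eq_zpow ⟨1, Or.inr (by simp)⟩

/-- The sections of `g` at level `n` are powers of `a_n` and of `b_n` with exponents bounded
by `K`. -/
def SmallSections (n K : ℕ) (g : sectionGroup l) : Prop :=
  ∀ p : LevelPath l n, ∃ i : ℤ, |i| ≤ K ∧ (sec g p = genA l n ^ i ∨ sec g p = genB l n ^ i)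

theorem smul_snoc_of_sec_genA {n : ℕ} {g : sectionGroup l} {p : LevelPath l n} {i : ℤ}
    (h : sec g p = genA l n ^ i) (x : ZMod (l n)) :
    g • snoc p x = snoc (g • p) (x + i) ∧ sec g (snoc p x) = 1 := by
  have H := hasSection_sec g p
  rw [h] at H
  exact smul_eq_and_sec_eq (H.snoc_genA x)

theorem smul_snoc_of_sec_genB {n : ℕ} {g : sectionGroup l} {p : LevelPath l n}
    {i : ℤ} (h : sec g p = genB l n ^ i) (x : ZMod (l n)) :
    g • snoc p x = snoc (g • p) x ∧ sec g (snoc p x) = (if x = 0 then genB l (n + 1) ^ i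
      else if x = 1 then genA l (n + 1) ^ i else 1) := by
  have H := hasSection_sec g p
  rw [h] at H
  exact smul_eq_and_sec_eq (H.snoc_genB x)

namespace SmallSections

variable {n K K' : ℕ} {g g' : sectionGroup l}

theorem succ (h : SmallSections n K g) : SmallSections (n + 1) K g := by
  intro p
  cases p with
  | snoc p x =>
    obtain ⟨i, hi, H | H⟩ := h p
    · exact ⟨0, by simp, Or.inl (by simpa using (smul_snoc_of_sec_genA H x).2)⟩
    · have H' := (smul_snoc_of_sec_genB H x).2
      split_ifs at H'
      · exact ⟨i, hi, Or.inr H'⟩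
      · exact ⟨i, hi, Or.inl H'⟩
      · exact ⟨0, by simp, Or.inl (by simpa using H')⟩

theorem mono_level (h : SmallSections n K g) {m : ℕ} (hm : n ≤ m) :
    SmallSections m K g := by
  induction m, hm using Nat.le_induction with
  | base => exact h
  | succ m _ ih => exact ih.succ

theorem mono (h : SmallSections n K g) (hK : K ≤ K') : SmallSections n K' g := fun p => by
  obtain ⟨i, hi, H⟩ := h p
  exact ⟨i, hi.trans (by exact_mod_cast hK), H⟩

theorem inv (h : SmallSections n K g) : SmallSections n K g⁻¹ := fun p => by
  obtain ⟨i, hi, H⟩ := h (g⁻¹ • p)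
  refine ⟨-i, by simpa using hi, ?_⟩
  rw [sec_inv, zpow_neg, zpow_neg, inv_inj, inv_inj]
  exact H

/-- A mixed product of a power of `a_n` and a power of `b_n` separates one level lower, because
`a_n` has trivial sections there. Exponents add only when both factors are powers of `b_n`. Level `n
+ 1` is already enough; the second level is slack. -/
theorem mul (h : SmallSections n K g) (h' : SmallSections n K' g') :
    SmallSections (n + 2) (K + K') (g * g') := by
  have key : ∀ p : LevelPath l n, ∀ x, (∃ i : ℤ, |i| ≤ (K + K' : ℕ) ∧
      (sec (g * g') (snoc p x) = genA l (n + 1) ^ i ∨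
        sec (g * g') (snoc p x) = genB l (n + 1) ^ i)) := by
    intro p x
    obtain ⟨i, hi, H⟩ := h (g' • p)
    obtain ⟨j, hj, H'⟩ := h' p
    push_cast
    have hb : ∀ k : ℤ, k = 0 ∨ k = i ∨ k = j ∨ k = i + j → |k| ≤ (K + K' : ℤ) := by
      rintro k hk
      rw [abs_le] at *
      omega
    rw [sec_mul]
    rcases H' with H' | H'
    · obtain ⟨e1, e2⟩ := smul_snoc_of_sec_genA H' x
      rw [e1, e2, mul_one]
      rcases H with H | H
      · rw [(smul_snoc_of_sec_genA H _).2]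
        exact ⟨0, hb _ (by simp), Or.inl (by simp)⟩
      · rw [(smul_snoc_of_sec_genB H _).2]
        split_ifs
        · exact ⟨i, hb _ (by simp), Or.inr rfl⟩
        · exact ⟨i, hb _ (by simp), Or.inl rfl⟩
        · exact ⟨0, hb _ (by simp), Or.inl (by simp)⟩
    · obtain ⟨e1, e2⟩ := smul_snoc_of_sec_genB H' x
      rw [e1, e2]
      rcases H with H | H
      · rw [(smul_snoc_of_sec_genA H _).2, one_mul]
        split_ifs
        · exact ⟨j, hb _ (by simp), Or.inr rfl⟩
        · exact ⟨j, hb _ (by simp), Or.inl rfl⟩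
        · exact ⟨0, hb _ (by simp), Or.inl (by simp)⟩
      · rw [(smul_snoc_of_sec_genB H _).2]
        split_ifs
        · exact ⟨i + j, hb _ (by simp), Or.inr (zpow_add _ _ _).symm⟩
        · exact ⟨i + j, hb _ (by simp), Or.inl (zpow_add _ _ _).symm⟩
        · exact ⟨0, hb _ (by simp), Or.inl (by simp)⟩
  refine SmallSections.succ (n := n + 1) fun p => ?_
  cases p with
  | snoc p x => exact key p x

end SmallSections

theorem smallSections_of_mem_generators {g : sectionGroup l}
    (hg : g.1 ∈ ({genA l 0, genB l 0} : Set (treeAut l 0))) : SmallSections 0 1 g := by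
  obtain ⟨g, hg'⟩ := g
  refine fun p => ⟨1, by simp, ?_⟩
  cases p
  rcases hg with rfl | rfl
  · exact Or.inl (smul_eq_and_sec_eq (q := nil) fun v => by simp).2
  · exact Or.inr (smul_eq_and_sec_eq (q := nil) fun v => by simp).2

theorem exists_smallSections (g : treeAut l 0) (hg : g ∈ spinalGroup l) :
    ∃ n K, SmallSections n K (⟨g, spinalGroup_le_sectionGroup hg⟩ : sectionGroup l) := by
  induction hg using Subgroup.closure_induction with
  | mem x hx => exact ⟨0, 1, smallSections_of_mem_generators hx⟩
  | one => exact ⟨0, 0, fun p => ⟨0, by simp, Or.inl ((sec_one p).trans (by simp))⟩⟩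
  | mul x y hx hy ihx ihy =>
    obtain ⟨n, K, h⟩ := ihx
    obtain ⟨n', K', h'⟩ := ihy
    exact ⟨_, _, (h.mono_level (le_max_left n n')).mul
      (h'.mono_level (le_max_right n n'))⟩
  | inv x hx ih =>
    obtain ⟨n, K, h⟩ := ih
    exact ⟨n, K, h.inv⟩

end Sections

/-! ### Stabilizers that move a child, or commuting sections below it. -/

section Dichotomy

open LevelPath

variable {l : ℕ → ℕ}

theorem exists_smul_snoc {n : ℕ} (g : sectionGroup l) (p : LevelPath l n) (x : ZMod (l n)) :
    ∃ y, g • snoc p x = snoc (g • p) y := by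
  have h1 := hasSection_sec g (snoc p x) (Vertex.root (n + 1))
  rw [attach_snoc, hasSection_sec g p] at h1
  generalize g • snoc p x = q at h1
  cases q with
  | snoc q y => exact ⟨y, by rw [(attach_inj h1).1]⟩

/-- By the cocycle rule, a section of a product is a product of sections of the factors along the
orbit of `p`. -/
theorem sec_mem_zpowers {n : ℕ} {T : Set (sectionGroup l)} {p : LevelPath l n} {c : treeAut l n}
    (h : ∀ u ∈ Subgroup.closure T, ∀ g ∈ T, sec g (u • p) ∈ Subgroup.zpowers c)
    {w : sectionGroup l} (hw : w ∈ Subgroup.closure T) :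
    ∀ u ∈ Subgroup.closure T, sec w (u • p) ∈ Subgroup.zpowers c := by
  induction hw using Subgroup.closure_induction with
  | mem g hg => exact fun u hu => h u hu g hg
  | one => exact fun u _ => by rw [sec_one]; exact one_mem _
  | mul a b ha hb iha ihb =>
    intro u hu
    rw [sec_mul, ← mul_smul]
    exact mul_mem (iha _ (mul_mem hb hu)) (ihb u hu)
  | inv a ha iha =>
    intro u hu
    rw [sec_inv, ← mul_smul]
    exact inv_mem (iha _ (mul_mem (inv_mem ha) hu))

theorem commute_sec_of_mem_zpowers {n : ℕ} {T : Set (sectionGroup l)} {p : LevelPath l n}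
    {c : treeAut l n}
    (h : ∀ u ∈ Subgroup.closure T, ∀ g ∈ T, sec g (u • p) ∈ Subgroup.zpowers c)
    {w w' : sectionGroup l} (hw : w ∈ Subgroup.closure T) (hw' : w' ∈ Subgroup.closure T) :
    Commute (sec w p) (sec w' p) := by
  obtain ⟨i, hi⟩ := sec_mem_zpowers h hw 1 (one_mem _)
  obtain ⟨j, hj⟩ := sec_mem_zpowers h hw' 1 (one_mem _)
  rw [one_smul] at hi hj
  rw [← hi, ← hj]
  exact (Commute.refl c).zpow_zpow i j

/-- The word `X00…0`. -/
def zeroRay {n : ℕ} (X : LevelPath l n) : ∀ k, LevelPath l (n + k)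
  | 0 => X
  | k + 1 => snoc (zeroRay X k) 0

/-- A power of `b` persists only along the letter `0`. Any other letter turns it into a power of `a`
or into `1`, and powers of `a` have trivial sections. -/
theorem sec_genA_of_ne_zeroRay {n K : ℕ} {g : sectionGroup l} (h : SmallSections n K g)
    {k : ℕ} (p : LevelPath l (n + k)) (hp : ∀ X : LevelPath l n, p ≠ zeroRay X k) :
    ∃ i : ℤ, sec g p = genA l (n + k) ^ i := by
  induction k with
  | zero => exact absurd rfl (hp p)
  | succ k ih =>
    change LevelPath l (n + k + 1) at p
    cases p with
    | snoc p x =>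
      by_cases hx : x = 0
      · subst hx
        obtain ⟨i, hi⟩ := ih p fun X hX => hp X (by rw [hX]; rfl)
        exact ⟨0, by rw [(smul_snoc_of_sec_genA hi 0).2, zpow_zero]⟩
      · obtain ⟨i, -, hi | hi⟩ := h.mono_level (Nat.le_add_right n k) p
        · exact ⟨0, by rw [(smul_snoc_of_sec_genA hi x).2, zpow_zero]⟩
        · have := (smul_snoc_of_sec_genB hi x).2
          rw [if_neg hx] at this
          split_ifs at this
          · exact ⟨i, this⟩
          · exact ⟨0, by rw [this, zpow_zero]⟩

/-- Pairs of words whose extensions by `k` zeros lie in the same orbit. -/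
def sameOrbit (Γ : Subgroup (sectionGroup l)) (n k : ℕ) : Set (LevelPath l n × LevelPath l n) :=
  {P | ∃ u ∈ Γ, u • zeroRay P.1 k = zeroRay P.2 k}

theorem sameOrbit_antitone (Γ : Subgroup (sectionGroup l)) (n : ℕ) :
    Antitone (sameOrbit Γ n) := by
  refine antitone_nat_of_succ_le fun k => ?_
  rintro ⟨X, Y⟩ ⟨u, hu, h⟩
  refine ⟨u, hu, ?_⟩
  obtain ⟨y, hy⟩ := exists_smul_snoc u (zeroRay X k) 0
  have h' := hy.symm.trans h
  injection h'

/-- These sets decrease with `k` inside a finite set. -/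
theorem exists_sameOrbit_stable (hl0 : ∀ i, l i ≠ 0) (Γ : Subgroup (sectionGroup l)) (n : ℕ) :
    ∃ k₀, ∀ k ≥ k₀, sameOrbit Γ n k = sameOrbit Γ n k₀ := by
  have := LevelPath.finite hl0 n
  obtain ⟨_, ⟨k₀, rfl⟩, hk⟩ := (wellFounded_lt (α := Set (LevelPath l n × LevelPath l n))).has_min
    (Set.range (sameOrbit Γ n)) ⟨_, 0, rfl⟩
  refine ⟨k₀, fun k hk' => ?_⟩
  by_contra h
  exact hk _ ⟨k, rfl⟩ (lt_of_le_of_ne (sameOrbit_antitone Γ n hk') h)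

/-- From some level on, the stabilizer of a vertex either moves a child of that vertex or acts on
the subtree below each child through a commutative group. -/
theorem exists_moves_child_or_commute (hl0 : ∀ i, l i ≠ 0)
    {T : Set (sectionGroup l)} {n₀ K : ℕ} (hT : ∀ g ∈ T, SmallSections n₀ K g) :
    ∃ n₁, ∀ n ≥ n₁, ∀ p : LevelPath l n,
      (∃ u ∈ Subgroup.closure T, u • p = p ∧ ∃ x, u • snoc p x ≠ snoc p x) ∨
      ∀ x, ∀ w ∈ Subgroup.closure T, ∀ w' ∈ Subgroup.closure T,
        Commute (sec w (snoc p x)) (sec w' (snoc p x)) := by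
  set Γ := Subgroup.closure T with hΓ
  obtain ⟨k₀, hk₀⟩ := exists_sameOrbit_stable hl0 Γ n₀
  refine ⟨n₀ + k₀, fun n hn p => ?_⟩
  obtain ⟨k, rfl⟩ := Nat.exists_eq_add_of_le (le_trans (Nat.le_add_right n₀ k₀) hn)
  replace hn : k₀ ≤ k := by omega
  refine or_iff_not_imp_left.2 fun hfix x => ?_
  push Not at hfix
  -- When the stabilizer of `p` fixes the children of `p`, the image of a child depends only on the
  -- image of `p`.
  have hfix' : ∀ u ∈ Γ, ∀ v ∈ Γ, u • p = v • p → u • snoc p x = v • snoc p x := by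
    intro u hu v hv h
    have := hfix (v⁻¹ * u) (mul_mem (inv_mem hv) hu) (by rw [mul_smul, h, inv_smul_smul]) x
    rwa [mul_smul, inv_smul_eq_iff] at this
  intro w hw w' hw'
  -- If the orbit of the child meets a zero ray, all generator sections along it are powers of `b`;
  -- otherwise all are powers of `a`. Either way they lie in one cyclic group.
  by_cases hX : ∃ X : LevelPath l n₀, ∃ v ∈ Γ, v • snoc p x = zeroRay X (k + 1)
  · obtain ⟨X, v, hv, hvX⟩ := hX
    refine commute_sec_of_mem_zpowers (T := T) (c := genB l (n₀ + k + 1)) ?_ hw hw'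
    intro u hu g hg
    obtain ⟨y, hy⟩ := exists_smul_snoc u p x
    rw [hy]
    obtain ⟨i, -, hi | hi⟩ := (hT g hg).mono_level (Nat.le_add_right n₀ k) (u • p)
    · rw [(smul_snoc_of_sec_genA hi y).2]; exact one_mem _
    · by_cases hY : ∃ Y : LevelPath l n₀, u • p = zeroRay Y k
      · obtain ⟨Y, hY⟩ := hY
        have hvp : v • p = zeroRay X k := by
          obtain ⟨z, hz⟩ := exists_smul_snoc v p x
          have h' := hz.symm.trans hvX
          injection h'
        -- Stability lifts the orbit relation between the rays from level `k` to level `k + 1`. With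
        -- `hfix'` this forces `y = 0`, so the section at `snoc (u • p) y` is a power of `b` and not
        -- of `a`.
        have hXY : (X, Y) ∈ sameOrbit Γ n₀ (k + 1) := by
          rw [hk₀ (k + 1) (by omega), ← hk₀ k hn]
          exact ⟨u * v⁻¹, mul_mem hu (inv_mem hv), by rw [mul_smul, ← hvp, inv_smul_smul, hY]⟩
        obtain ⟨t, ht, htXY⟩ := hXY
        have htp : (t * v) • snoc p x = snoc (u • p) 0 := by
          rw [mul_smul, hvX, hY]; exact htXY
        have htp' : (t * v) • p = u • p := by
          obtain ⟨z, hz⟩ := exists_smul_snoc (t * v) p x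
          have h' := hz.symm.trans htp
          injection h'
        have h0 := hfix' (t * v) (mul_mem ht hv) u hu htp'
        rw [htp, hy] at h0
        injection h0 with _ _ h0
        rw [(smul_snoc_of_sec_genB hi y).2, if_pos h0.symm]
        exact ⟨i, rfl⟩
      · obtain ⟨j, hj⟩ := sec_genA_of_ne_zeroRay (hT g hg) (u • p) (fun Y h => hY ⟨Y, h⟩)
        rw [(smul_snoc_of_sec_genA hj y).2]; exact one_mem _
  · refine commute_sec_of_mem_zpowers (T := T) (c := genA l (n₀ + k + 1)) ?_ hw hw'
    intro u hu g hg
    obtain ⟨i, hi⟩ := sec_genA_of_ne_zeroRay (k := k + 1) (hT g hg) (u • snoc p x)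
      (fun X h => hX ⟨X, u, hu, h⟩)
    exact ⟨i, hi.symm⟩

end Dichotomy

/-! ### Bounded translations of one letter. -/

section Spread

open LevelPath

variable {l : ℕ → ℕ}

/-- `w` adds a number of absolute value at most `K` to the letter following each word of length
`n`, and its section after this letter is trivial unless the letter is near `0`. -/
def HalfSpread (n K : ℕ) (w : sectionGroup l) : Prop :=
  ∀ p : LevelPath l n, (∃ c : ℤ, |c| ≤ K ∧ ∀ x, w • snoc p x = snoc (w • p) (x + c)) ∧
    ∀ x, sec w (snoc p x) ≠ 1 → ∃ c : ℤ, |c| ≤ K + 1 ∧ x = c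

/-- Both `w` and `w⁻¹` satisfy `HalfSpread`. -/
def Spread (n K : ℕ) (w : sectionGroup l) : Prop := HalfSpread n K w ∧ HalfSpread n K w⁻¹

theorem HalfSpread.mul {n K K' : ℕ} {w w' : sectionGroup l} (h : HalfSpread n K w)
    (h' : HalfSpread n K' w') : HalfSpread n (K + K') (w * w') := by
  intro p
  obtain ⟨⟨c', hc', h1'⟩, h2'⟩ := h' p
  obtain ⟨⟨c, hc, h1⟩, h2⟩ := h (w' • p)
  rw [abs_le] at hc hc'
  refine ⟨⟨c + c', by rw [abs_le]; push_cast; omega, fun x => ?_⟩, fun x hx => ?_⟩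
  · rw [mul_smul, h1', h1, mul_smul]; push_cast; congr 1; ring
  · rw [sec_mul, h1'] at hx
    by_cases hx' : sec w' (snoc p x) = 1
    · rw [hx', mul_one] at hx
      obtain ⟨d, hd, hxd⟩ := h2 _ hx
      rw [abs_le] at hd
      refine ⟨d - c', by rw [abs_le]; push_cast; omega, ?_⟩
      push_cast
      rw [← hxd]; ring
    · obtain ⟨d, hd, hxd⟩ := h2' _ hx'
      rw [abs_le] at hd
      exact ⟨d, by rw [abs_le]; push_cast; omega, hxd⟩

theorem HalfSpread.of_smallSections {n K : ℕ} {w : sectionGroup l} (h : SmallSections n K w) :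
    HalfSpread n K w := by
  intro p
  obtain ⟨i, hi, H | H⟩ := h p
  · exact ⟨⟨i, hi, fun x => (smul_snoc_of_sec_genA H x).1⟩,
      fun x hx => absurd (smul_snoc_of_sec_genA H x).2 hx⟩
  · refine ⟨⟨0, by simp, fun x => by simpa using (smul_snoc_of_sec_genB H x).1⟩, fun x hx => ?_⟩
    rw [(smul_snoc_of_sec_genB H x).2] at hx
    split_ifs at hx with h0 h1
    · exact ⟨0, by simp; positivity, by simpa using h0⟩
    -- The letter `1`, below which `b_n` acts as `a_{n+1}`, is the reason for the bound `K + 1`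
    -- instead of `K`.
    · exact ⟨1, by simp, by simpa using h1⟩
    · exact absurd rfl hx

theorem HalfSpread.one {n : ℕ} : HalfSpread n 0 (1 : sectionGroup l) := fun p =>
  ⟨⟨0, by simp, by simp⟩, fun _ h => absurd (sec_one _) h⟩

namespace Spread

variable {n K K' : ℕ} {w w' : sectionGroup l}

theorem one : Spread n 0 (1 : sectionGroup l) :=
  ⟨HalfSpread.one, by rw [inv_one]; exact HalfSpread.one⟩

theorem mul (h : Spread n K w) (h' : Spread n K' w') : Spread n (K + K') (w * w') :=
  ⟨h.1.mul h'.1, by rw [mul_inv_rev, add_comm]; exact h'.2.mul h.2⟩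

theorem inv (h : Spread n K w) : Spread n K w⁻¹ := ⟨h.2, by rw [inv_inv]; exact h.1⟩

theorem pow (h : Spread n K w) (r : ℕ) : Spread n (r * K) (w ^ r) := by
  induction r with
  | zero => simpa using one
  | succ r ih => rw [pow_succ, add_mul, one_mul]; exact ih.mul h

theorem of_smallSections (h : SmallSections n K w) : Spread n K w :=
  ⟨HalfSpread.of_smallSections h, HalfSpread.of_smallSections h.inv⟩

theorem mono (h : Spread n K w) (hK : K ≤ K') : Spread n K' w := by
  have key : ∀ w : sectionGroup l, HalfSpread n K w → HalfSpread n K' w := fun w h p => by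
    obtain ⟨⟨c, hc, h1⟩, h2⟩ := h p
    refine ⟨⟨c, by omega, h1⟩, fun x hx => ?_⟩
    obtain ⟨d, hd, hxd⟩ := h2 x hx
    exact ⟨d, by omega, hxd⟩
  exact ⟨key _ h.1, key _ h.2⟩

end Spread

end Spread

/-! ### Short words, and the commutator that kills the sections below one vertex. -/

section Words

open LevelPath
open scoped commutatorElement

variable {l : ℕ → ℕ}

theorem exists_spread {g : treeAut l 0} (hg : g ∈ spinalGroup l) (n : ℕ) :
    ∃ K, Spread n K (⟨g, spinalGroup_le_sectionGroup hg⟩ : sectionGroup l) := by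
  induction hg using Subgroup.closure_induction with
  | mem x hx =>
    exact ⟨1, Spread.of_smallSections
      ((smallSections_of_mem_generators hx).mono_level (Nat.zero_le n))⟩
  | one => exact ⟨0, Spread.one⟩
  | mul x y hx hy ihx ihy =>
    obtain ⟨K, h⟩ := ihx
    obtain ⟨K', h'⟩ := ihy
    exact ⟨_, h.mul h'⟩
  | inv x hx ih =>
    obtain ⟨K, h⟩ := ih
    exact ⟨K, h.inv⟩

theorem pow_smul_snoc {n : ℕ} {g : sectionGroup l} {p : LevelPath l n} {c : ℤ} (hp : g • p = p)
    (h : ∀ x, g • snoc p x = snoc (g • p) (x + c)) (r : ℕ) (x : ZMod (l n)) :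
    g ^ r • snoc p x = snoc p (x + (r * c : ℤ)) := by
  induction r with
  | zero => simp
  | succ r ih =>
    rw [pow_succ', mul_smul, ih, h, hp]
    push_cast; congr 1; ring

/-- Once a power of `g` fixes `p`, it translates the next letter by a constant, so its `l n`-th
power fixes the children of `p`. -/
theorem pow_prod_smul {g : sectionGroup l} (h : ∀ n, ∃ K, Spread n K g) (n : ℕ)
    (p : LevelPath l n) : g ^ (∏ j ∈ Finset.range n, l j) • p = p := by
  induction p with
  | nil => generalize g ^ _ • (nil : LevelPath l 0) = q; cases q; rfl
  | @snoc n p x ih =>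
    obtain ⟨K, hK⟩ := h n
    obtain ⟨⟨c, -, hc⟩, -⟩ := (hK.pow (∏ j ∈ Finset.range n, l j)).1 p
    rw [Finset.prod_range_succ, pow_mul, pow_smul_snoc ih hc]
    simp

theorem sec_inv_of_smul_eq {n : ℕ} {g : sectionGroup l} {p : LevelPath l n} (h : g • p = p) :
    sec g⁻¹ p = (sec g p)⁻¹ := by
  rw [sec_inv, inv_smul_eq_iff.2 h.symm]

theorem commutator_smul_of_smul_eq {n : ℕ} {g h : sectionGroup l} {p : LevelPath l n}
    (hg : g • p = p) (hh : h • p = p) : ⁅g, h⁆ • p = p := by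
  rw [commutatorElement_def, mul_smul, mul_smul, mul_smul, inv_smul_eq_iff.2 hh.symm,
    inv_smul_eq_iff.2 hg.symm, hh, hg]

theorem sec_commutator {n : ℕ} {g h : sectionGroup l} {p : LevelPath l n}
    (hg : g • p = p) (hh : h • p = p) : sec ⁅g, h⁆ p = ⁅sec g p, sec h p⁆ := by
  have hg' := inv_smul_eq_iff.2 hg.symm
  have hh' := inv_smul_eq_iff.2 hh.symm
  rw [commutatorElement_def, commutatorElement_def, sec_mul, sec_mul, sec_mul, hh', hg', hh,
    sec_inv_of_smul_eq hg, sec_inv_of_smul_eq hh]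

theorem sec_conj_eq_one {n : ℕ} {t w : sectionGroup l} {p : LevelPath l n}
    (hw : w • (t⁻¹ • p) = t⁻¹ • p) (h : sec w (t⁻¹ • p) = 1) : sec (t * w * t⁻¹) p = 1 := by
  rw [sec_mul, sec_mul, hw, h, sec_inv, mul_one, mul_inv_cancel]

theorem conj_smul_eq {n : ℕ} {t w : sectionGroup l} (hw : ∀ p : LevelPath l n, w • p = p)
    (p : LevelPath l n) : (t * w * t⁻¹) • p = p := by
  rw [mul_smul, mul_smul, hw, smul_inv_smul]

theorem Spread.commutator {n K K' : ℕ} {g h : sectionGroup l} (hg : Spread n K g)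
    (hh : Spread n K' h) : Spread n (2 * K + 2 * K') ⁅g, h⁆ := by
  rw [commutatorElement_def]
  exact (((hg.mul hh).mul hg.inv).mul hh.inv).mono (by omega)

variable (φ : FreeGroup (Fin 2) →* sectionGroup l) {n L : ℕ}

/-- Each vertex in the orbit of `q` is the image of `q` under a short word. -/
theorem exists_spread_smul_eq (hl0 : ∀ i, l i ≠ 0)
    (hL : ∀ j, Spread n L (φ (FreeGroup.of j))) (q : LevelPath l n) (w : FreeGroup (Fin 2)) :
    ∃ t, Spread n ((∏ j ∈ Finset.range n, l j) * L) (φ t) ∧ φ t • q = φ w • q := by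
  classical
  have := LevelPath.finite hl0 n
  have := Fintype.ofFinite (LevelPath l n)
  -- This is the Schreier graph on level `n`. A path in it visits each vertex at most once, so it
  -- has fewer than `m` edges.
  let G := SimpleGraph.fromRel fun q q' : LevelPath l n => ∃ j, φ (FreeGroup.of j) • q = q'
  have hreach : ∀ w q, G.Reachable q (φ w • q) := by
    intro w
    induction w using FreeGroup.induction_on with
    | C1 => intro q; rw [map_one, one_smul]
    | of j =>
      intro q
      by_cases h : q = φ (FreeGroup.of j) • q
      · rw [← h]
      · exact SimpleGraph.Adj.reachable
          ((SimpleGraph.fromRel_adj _ _ _).2 ⟨h, Or.inl ⟨j, rfl⟩⟩)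
    | inv_of j ih =>
      intro q
      have := ih (φ (FreeGroup.of j)⁻¹ • q)
      rw [map_inv, smul_inv_smul] at this
      rw [map_inv]; exact this.symm
    | mul x y hx hy =>
      intro q
      rw [map_mul, mul_smul]
      exact (hy q).trans (hx _)
  have hwalk : ∀ q q' (W : G.Walk q q'), ∃ t, Spread n (W.length * L) (φ t) ∧ φ t • q = q' := by
    intro q q' W
    induction W with
    | nil => exact ⟨1, by simpa using Spread.one, by simp⟩
    | @cons q r q' hadj W ih =>
      obtain ⟨t, ht, htr⟩ := ih
      obtain ⟨s, hs, hsr⟩ : ∃ s, Spread n L (φ s) ∧ φ s • q = r := by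
        rcases ((SimpleGraph.fromRel_adj _ _ _).1 hadj).2 with ⟨j, hj⟩ | ⟨j, hj⟩
        · exact ⟨_, hL j, hj⟩
        · refine ⟨(FreeGroup.of j)⁻¹, ?_, ?_⟩
          · rw [map_inv]; exact (hL j).inv
          · rw [map_inv, inv_smul_eq_iff, hj]
      refine ⟨t * s, ?_, ?_⟩
      · rw [map_mul, SimpleGraph.Walk.length_cons, add_mul, one_mul]; exact ht.mul hs
      · rw [map_mul, mul_smul, hsr, htr]
  obtain ⟨W, hW⟩ := (hreach w q).exists_isPath
  obtain ⟨t, ht, htq⟩ := hwalk _ _ W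
  refine ⟨t, ht.mono (Nat.mul_le_mul_right L ?_), htq⟩
  have h := hW.length_lt
  rw [← Nat.card_eq_fintype_card, LevelPath.card] at h
  exact h.le

/-- If the stabilizer of `p` moves a child of `p`, then so does a short word fixing `p`. -/
theorem exists_spread_loop (hl0 : ∀ i, l i ≠ 0)
    (hL : ∀ j, Spread n L (φ (FreeGroup.of j))) {p : LevelPath l n} {w₀ : FreeGroup (Fin 2)}
    (hp : φ w₀ • p = p) {x₀ : ZMod (l n)} (hx₀ : φ w₀ • snoc p x₀ ≠ snoc p x₀) :
    ∃ u, Spread n ((2 * (∏ j ∈ Finset.range n, l j) + 1) * L) (φ u) ∧ φ u • p = p ∧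
      ∃ x, φ u • snoc p x ≠ snoc p x := by
  by_contra hcon
  push Not at hcon
  set m := ∏ j ∈ Finset.range n, l j
  -- Schreier's argument: if every short loop at `p` fixes the children, transport of children along
  -- short words is consistent with every generator, hence with every word, in particular with `w₀`.
  have key : ∀ w t t', Spread n (m * L) (φ t) → Spread n (m * L) (φ t') →
      φ t' • p = φ w • φ t • p → ∀ x, φ t' • snoc p x = φ w • φ t • snoc p x := by
    have hgen : ∀ g, Spread n L (φ g) → ∀ t t', Spread n (m * L) (φ t) →
        Spread n (m * L) (φ t') →
        φ t' • p = φ g • φ t • p → ∀ x, φ t' • snoc p x = φ g • φ t • snoc p x := by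
      intro g hg t t' ht ht' h x
      have := hcon (t'⁻¹ * (g * t)) (by
        rw [map_mul, map_mul, map_inv]
        exact (ht'.inv.mul (hg.mul ht)).mono (by rw [add_mul, mul_assoc]; omega))
        (by rw [map_mul, map_mul, map_inv, mul_smul, mul_smul, inv_smul_eq_iff, h]) x
      rw [map_mul, map_mul, map_inv, mul_smul, mul_smul, inv_smul_eq_iff] at this
      exact this.symm
    intro w
    induction w using FreeGroup.induction_on with
    | C1 => exact hgen 1 (by rw [map_one]; exact Spread.one.mono (Nat.zero_le L))
    | of j => exact hgen _ (hL j)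
    | inv_of j _ => exact hgen _ (by rw [map_inv]; exact (hL j).inv)
    | mul a b iha ihb =>
      intro t t' ht ht' h x
      obtain ⟨s, hs, hsp⟩ := exists_spread_smul_eq φ hl0 hL p (b * t)
      rw [map_mul, mul_smul] at hsp
      rw [map_mul, mul_smul] at h ⊢
      rw [iha s t' hs ht' (by rw [h, hsp]) x, ihb t s ht hs hsp x]
  have h1 : Spread n (m * L) (φ 1) := by
    rw [map_one]; exact Spread.one.mono (Nat.zero_le _)
  have := key w₀ 1 1 h1 h1 (by rw [map_one, one_smul, hp]) x₀
  rw [map_one, one_smul] at this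
  exact hx₀ this.symm

/-- Replacing `w` by its commutator with a suitable conjugate makes its sections below `p`
trivial. -/
theorem exists_commutator_sec_eq_one {w : FreeGroup (Fin 2)} (hw1 : w ≠ 1) {K U Y : ℕ}
    (hwK : Spread n K (φ w)) (hw : ∀ q : LevelPath l (n + 1), φ w • q = q)
    {p : LevelPath l n} {u y y' : FreeGroup (Fin 2)}
    (hu : Spread n U (φ u)) (hup : φ u • p = p) {x₀ : ZMod (l n)}
    (hux : φ u • snoc p x₀ ≠ snoc p x₀)
    (hy : Spread n Y (φ y)) (hyp : φ y • p = p) (hy' : Spread n Y (φ y')) (hyp' : φ y' • p = p)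
    (hyy' : ¬ Commute y y') {T : ℕ} (hT : (2 * K + 3 + Y) * U + Y ≤ T)
    (hTl : T + 2 * K + 2 < l n) :
    ∃ w', w' ≠ 1 ∧ Spread n (4 * K + 4 * T) (φ w') ∧
      (∀ q : LevelPath l (n + 1), φ w' • q = q) ∧
      (∀ q : LevelPath l (n + 1), sec (φ w) q = 1 → sec (φ w') q = 1) ∧
      ∀ x, sec (φ w') (snoc p x) = 1 := by
  -- As `u` shifts by some `s ≠ 0`, the word `u ^ r` shifts by at least `r`. A further factor of
  -- shift at most `Y` leaves at least `2K + 3`, more than the diameter `2K + 2` of the interval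
  -- `[-(K+1), K+1]`.
  set r := 2 * K + 3 + Y with hr
  obtain ⟨⟨s, hsU, hs⟩, -⟩ := hu.1 p
  have hs0 : s ≠ 0 := by
    rintro rfl
    exact hux (by rw [hs, hup]; simp)
  obtain ⟨t, ht, htT, htp, c, hc1, hc2, htc⟩ : ∃ t, ¬ Commute w t ∧ Spread n T (φ t) ∧
      φ t • p = p ∧ ∃ c : ℤ, (2 * K + 3 : ℤ) ≤ |c| ∧ |c| ≤ T ∧
        ∀ x, φ t • snoc p x = snoc p (x + c) := by
    have hcand : ∀ z, Spread n Y (φ z) → φ z • p = p → Spread n T (φ (u ^ r * z)) ∧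
        φ (u ^ r * z) • p = p ∧ ∃ c : ℤ, (2 * K + 3 : ℤ) ≤ |c| ∧ |c| ≤ T ∧
        ∀ x, φ (u ^ r * z) • snoc p x = snoc p (x + c) := by
      intro z hz hzp
      obtain ⟨⟨d, hd, hzd⟩, -⟩ := hz.1 p
      have hupr : (φ u) ^ r • p = p := by
        clear_value r
        clear hr hT
        induction r with
        | zero => simp
        | succ r ih => rw [pow_succ, mul_smul, hup, ih]
      refine ⟨?_, ?_, r * s + d, ?_, ?_, fun x => ?_⟩
      · rw [map_mul, map_pow]
        exact ((hu.pow r).mul hz).mono hT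
      · rw [map_mul, map_pow, mul_smul, hzp, hupr]
      · have h1 : (r : ℤ) ≤ |r * s| := by
          rw [abs_mul, Nat.abs_cast]
          have := Int.one_le_abs hs0
          nlinarith
        have h2 := abs_sub_abs_le_abs_sub (r * s) (-d)
        rw [abs_neg, sub_neg_eq_add] at h2
        have h3 : (r : ℤ) = 2 * K + 3 + Y := by rw [hr]; push_cast; ring
        linarith
      · have h1 : |(r : ℤ) * s| ≤ r * U := by
          rw [abs_mul, Nat.abs_cast]
          exact mul_le_mul_of_nonneg_left hsU (by positivity)
        have h2 := abs_add_le ((r : ℤ) * s) d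
        have h3 : ((r * U + Y : ℕ) : ℤ) ≤ T := by exact_mod_cast hT
        push_cast at h3
        linarith
      · rw [map_mul, map_pow, mul_smul, hzd, hzp, pow_smul_snoc hup hs]
        push_cast; congr 1; ring
    by_cases h0 : Commute w (u ^ r * 1)
    · rw [mul_one] at h0
      -- If `w` commuted with `u ^ r`, `u ^ r * y` and `u ^ r * y'`, it would commute with `y` and
      -- `y'`, which would then commute with each other.
      have hz : ¬ Commute w (u ^ r * y) ∨ ¬ Commute w (u ^ r * y') := by
        by_contra! h
        have hcancel : ∀ z, Commute w (u ^ r * z) → Commute w z := fun z hz => by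
          simpa using h0.inv_right.mul_right hz
        exact hyy' (IsFreeGroup.commute_trans hw1 (hcancel _ h.1) (hcancel _ h.2))
      rcases hz with hz | hz
      · exact ⟨_, hz, hcand y hy hyp⟩
      · exact ⟨_, hz, hcand y' hy' hyp'⟩
    · exact ⟨_, h0, hcand 1 (by rw [map_one]; exact Spread.one.mono (Nat.zero_le _)) (by simp)⟩
  have hv : ∀ q : LevelPath l (n + 1), φ (t * w * t⁻¹) • q = q := fun q => by
    rw [map_mul, map_mul, map_inv]; exact conj_smul_eq hw q
  refine ⟨⁅w, t * w * t⁻¹⁆, ?_, ?_, ?_, ?_, ?_⟩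
  · rw [Ne, commutatorElement_eq_one_iff_commute]
    exact fun h => ht (FreeGroup.commute_of_commute_conj h)
  · rw [map_commutatorElement]
    refine (hwK.commutator (K' := T + K + T) ?_).mono (by omega)
    rw [map_mul, map_mul, map_inv]
    exact (htT.mul hwK).mul htT.inv
  · intro q
    rw [map_commutatorElement]
    exact commutator_smul_of_smul_eq (hw q) (hv q)
  · intro q hq
    rw [map_commutatorElement, sec_commutator (hw q) (hv q), hq, commutatorElement_one_left]
  · intro x
    rw [map_commutatorElement, sec_commutator (hw _) (hv _)]
    by_cases h : sec (φ w) (snoc p x) = 1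
    · rw [h, commutatorElement_one_left]
    · have h' : sec (φ (t * w * t⁻¹)) (snoc p x) = 1 := by
        have htx : (φ t)⁻¹ • snoc p x = snoc p (x - c) := by
          rw [inv_smul_eq_iff, htc, sub_add_cancel]
        rw [map_mul, map_mul, map_inv]
        refine sec_conj_eq_one (hw _) ?_
        rw [htx]
        by_contra h'
        obtain ⟨e, he, hxe⟩ := (hwK.1 p).2 _ h
        obtain ⟨f, hf, hxf⟩ := (hwK.1 p).2 _ h'
        -- The bound `T + 2K + 2 < l n` rules out wrapping around the cycle, so `c = e - f` holds in
        -- the integers, against `|c| ≥ 2K + 3`.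
        have h0 : ((e - c - f : ℤ) : ZMod (l n)) = 0 := by
          push_cast; rw [← hxe, ← hxf, sub_self]
        rw [ZMod.intCast_zmod_eq_zero_iff_dvd] at h0
        have hlt : |e - c - f| < l n := by
          have : ((T + 2 * K + 2 : ℕ) : ℤ) < l n := by exact_mod_cast hTl
          push_cast at this
          rw [abs_le] at he hf hc2
          rw [abs_lt]; constructor <;> linarith
        have := Int.eq_zero_of_abs_lt_dvd h0 hlt
        have hc : c = e - f := by linarith
        rw [hc] at hc1
        have := abs_sub e f
        linarith
      rw [h', commutatorElement_one_right]

end Words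

/-! ### The numerical condition. -/

section Growth

/-- The growth condition makes `l n` eventually dominate `(56 L m_n) ^ (m_n + 1)`. -/
theorem exists_pow_le_of_growth {l : ℕ → ℕ} (hl : ∀ i, 7 ≤ l i)
    (hgrowth : ∀ i, 1 ≤ i → (25 * l (i - 1)) ^ (3 * ∏ j ∈ Finset.range i, l j) ≤ l i) (L N : ℕ) :
    ∃ n ≥ N, (56 * ((∏ j ∈ Finset.range n, l j) * L)) ^ (∏ j ∈ Finset.range n, l j + 1) ≤ l n := by
  obtain ⟨k, hkN, hkL, hk1⟩ : ∃ k, N ≤ k ∧ 56 * L ≤ k ∧ 1 ≤ k :=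
    -- With `k ≥ 56L`, the product `M ≥ 7 ^ k` absorbs the constant `56L`.
    ⟨N + 56 * L + 1, by omega, by omega, by omega⟩
  refine ⟨k + 1, by omega, ?_⟩
  have hg := hgrowth (k + 1) (by omega)
  have hgk := hgrowth k hk1
  rw [Nat.add_sub_cancel] at hg
  rw [Finset.prod_range_succ] at hg ⊢
  set M := ∏ j ∈ Finset.range k, l j with hM
  have hkM : k ≤ M := by
    have h7 : 7 ^ k ≤ M := by
      simpa using Finset.pow_card_le_prod (s := Finset.range k) (f := l) (n := 7)
        (fun i _ => hl i)
    exact (Nat.lt_pow_self (by norm_num)).le.trans h7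
  have hM1 : 1 ≤ M := hk1.trans hkM
  -- The growth condition at `k` makes powers of `M` negligible against `l k`; the condition at `k +
  -- 1` is used only in the last line.
  have hM4 : M ^ 4 ≤ l k := by
    calc M ^ 4 ≤ (2 ^ M) ^ 4 := Nat.pow_le_pow_left Nat.lt_two_pow_self.le 4
      _ = 16 ^ M := by rw [← pow_mul, mul_comm, pow_mul]; norm_num
      _ ≤ (25 * l (k - 1)) ^ M := Nat.pow_le_pow_left (by linarith [hl (k - 1)]) M
      _ ≤ (25 * l (k - 1)) ^ (3 * M) :=
          Nat.pow_le_pow_right (by linarith [hl (k - 1)]) (by omega)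
      _ ≤ l k := hgk
  have hMl : 1 ≤ M * l k := Nat.mul_pos hM1 (by linarith [hl k])
  have hbase : 56 * (M * l k * L) ≤ M ^ 2 * l k := by
    calc 56 * (M * l k * L) = M * l k * (56 * L) := by ring
      _ ≤ M * l k * M := Nat.mul_le_mul_left _ (hkL.trans hkM)
      _ = M ^ 2 * l k := by ring
  have hbase1 : 1 ≤ M ^ 2 * l k := Nat.mul_pos (by positivity) (by linarith [hl k])
  calc (56 * (M * l k * L)) ^ (M * l k + 1)
      ≤ (M ^ 2 * l k) ^ (M * l k + 1) := Nat.pow_le_pow_left hbase _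
    _ ≤ (M ^ 2 * l k) ^ (2 * (M * l k)) := Nat.pow_le_pow_right hbase1 (by omega)
    _ = (M ^ 4 * l k ^ 2) ^ (M * l k) := by rw [pow_mul]; congr 1; ring
    _ ≤ (l k * l k ^ 2) ^ (M * l k) :=
        Nat.pow_le_pow_left (Nat.mul_le_mul_right _ hM4) _
    _ = (l k ^ 3) ^ (M * l k) := by congr 1; ring
    _ ≤ ((25 * l k) ^ 3) ^ (M * l k) :=
        Nat.pow_le_pow_left (Nat.pow_le_pow_left (by linarith [hl k]) 3) _
    _ = (25 * l k) ^ (3 * (M * l k)) := by rw [← pow_mul]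
    _ ≤ l (k + 1) := hg

end Growth

/-! ### Construction of the relation. -/

section Law

open LevelPath
open scoped commutatorElement

variable {l : ℕ → ℕ}

/-- The commutator `w₁` of the `m`-th powers of the generators fixes level `n + 1`, because
translations of a letter commute. Sections of a commutator are commutators of sections only at
vertices fixed by both entries, so a second commutator, of `w₁` with a conjugate, is needed. -/
theorem exists_ne_one_commutator_trivial (φ : FreeGroup (Fin 2) →* sectionGroup l) {n L : ℕ}
    (hL : ∀ j, Spread n L (φ (FreeGroup.of j)))
    (hy : ∀ j (p : LevelPath l n),
      φ (FreeGroup.of j ^ ∏ j ∈ Finset.range n, l j) • p = p)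
    (hm : 1 ≤ ∏ j ∈ Finset.range n, l j) :
    ∃ w, w ≠ 1 ∧ Spread n (20 * ((∏ j ∈ Finset.range n, l j) * L)) (φ w) ∧
      (∀ q : LevelPath l (n + 1), φ w • q = q) ∧
      ∀ q : LevelPath l (n + 1), (∀ v v', Commute (sec (φ v) q) (sec (φ v') q)) →
        sec (φ w) q = 1 := by
  set m := ∏ j ∈ Finset.range n, l j
  have hyS : ∀ j, Spread n (m * L) (φ (FreeGroup.of j ^ m)) := fun j => by
    rw [map_pow]; exact (hL j).pow m
  have hyy := FreeGroup.not_commute_of_pow (i := m) (j := m) (by omega) (by omega)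
  set w₁ : FreeGroup (Fin 2) := ⁅FreeGroup.of (0 : Fin 2) ^ m, FreeGroup.of (1 : Fin 2) ^ m⁆ with hw₁
  have hw₁1 : w₁ ≠ 1 := by rwa [hw₁, Ne, commutatorElement_eq_one_iff_commute]
  have hw₁S : Spread n (4 * (m * L)) (φ w₁) := by
    rw [hw₁, map_commutatorElement]
    exact ((hyS 0).commutator (hyS 1)).mono (by omega)
  have hw₁t : ∀ q : LevelPath l (n + 1), φ w₁ • q = q := by
    intro q
    cases q with
    | snoc p x =>
      obtain ⟨⟨c, -, hc⟩, -⟩ := (hyS 0).1 p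
      obtain ⟨⟨d, -, hd⟩, -⟩ := (hyS 1).1 p
      rw [hy] at hc hd
      have h₁ : (φ (FreeGroup.of 1 ^ m) * φ (FreeGroup.of 0 ^ m)) • snoc p (x - c - d) =
          snoc p x := by
        rw [mul_smul, hc, hd]; congr 1; ring
      have h₂ : (φ (FreeGroup.of 0 ^ m) * φ (FreeGroup.of 1 ^ m)) • snoc p (x - c - d) =
          snoc p x := by
        rw [mul_smul, hd, hc]; congr 1; ring
      rw [hw₁, map_commutatorElement, commutatorElement_def, mul_assoc _ _⁻¹, ← mul_inv_rev,
        mul_smul, inv_smul_eq_iff.2 h₁.symm, h₂]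
  obtain ⟨j, hj⟩ : ∃ j, ¬ Commute w₁ (FreeGroup.of j) := by
    by_contra! h
    have := IsFreeGroup.commute_trans hw₁1 (h 0) (h 1)
    exact FreeGroup.not_commute_of_pow one_ne_zero one_ne_zero (by simpa using this)
  have hvt : ∀ q : LevelPath l (n + 1), φ (FreeGroup.of j * w₁ * (FreeGroup.of j)⁻¹) • q = q :=
    fun q => by rw [map_mul, map_mul, map_inv]; exact conj_smul_eq hw₁t q
  refine ⟨⁅w₁, FreeGroup.of j * w₁ * (FreeGroup.of j)⁻¹⁆, ?_, ?_, fun q => ?_, fun q hq => ?_⟩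
  · rw [Ne, commutatorElement_eq_one_iff_commute]
    exact fun h => hj (FreeGroup.commute_of_commute_conj h)
  · rw [map_commutatorElement]
    refine (hw₁S.commutator (K' := L + 4 * (m * L) + L) ?_).mono ?_
    · rw [map_mul, map_mul, map_inv]
      exact ((hL j).mul hw₁S).mul (hL j).inv
    · have : L ≤ m * L := Nat.le_mul_of_pos_left L hm
      omega
  · rw [map_commutatorElement]
    exact commutator_smul_of_smul_eq (hw₁t q) (hvt q)
  · rw [map_commutatorElement, sec_commutator (hw₁t q) (hvt q),
      commutatorElement_eq_one_iff_commute]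
    exact hq _ _

/-- If `l n` is large, and the stabilizer of each vertex of level `n` moves a child of it or has
commuting sections at all its children, then `φ` is not injective. -/
theorem exists_ne_one_map_eq_one (φ : FreeGroup (Fin 2) →* sectionGroup l) {n L : ℕ}
    (hl0 : ∀ i, l i ≠ 0) (hL1 : 1 ≤ L) (hL : ∀ j, Spread n L (φ (FreeGroup.of j)))
    (hy : ∀ j (p : LevelPath l n),
      φ (FreeGroup.of j ^ ∏ j ∈ Finset.range n, l j) • p = p)
    (hdich : ∀ p : LevelPath l n, (∃ u, φ u • p = p ∧ ∃ x, φ u • snoc p x ≠ snoc p x) ∨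
      ∀ x v v', Commute (sec (φ v) (snoc p x)) (sec (φ v') (snoc p x)))
    (hln : (56 * ((∏ j ∈ Finset.range n, l j) * L)) ^ (∏ j ∈ Finset.range n, l j + 1) ≤ l n) :
    ∃ w, w ≠ 1 ∧ φ w = 1 := by
  classical
  have := LevelPath.finite hl0 n
  have := Fintype.ofFinite (LevelPath l n)
  have hcard : (Finset.univ : Finset (LevelPath l n)).card = ∏ j ∈ Finset.range n, l j := by
    rw [Finset.card_univ, ← Nat.card_eq_fintype_card, LevelPath.card]
  have hm : 1 ≤ ∏ j ∈ Finset.range n, l j := Finset.prod_pos fun i _ => (hl0 i).bot_lt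
  obtain ⟨w₀, hw₀1, hw₀S, hw₀t, hw₀c⟩ := exists_ne_one_commutator_trivial φ hL hy hm
  set m := ∏ j ∈ Finset.range n, l j
  have hmL : 1 ≤ m * L := Nat.mul_pos hm hL1
  have hyS : ∀ j, Spread n (m * L) (φ (FreeGroup.of j ^ m)) := fun j => by
    rw [map_pow]; exact (hL j).pow m
  have hyy := FreeGroup.not_commute_of_pow (i := m) (j := m) (by omega) (by omega)
  have key : ∀ s : Finset (LevelPath l n), ∃ w, w ≠ 1 ∧
      Spread n ((56 * (m * L)) ^ s.card * (20 * (m * L))) (φ w) ∧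
      (∀ q : LevelPath l (n + 1), φ w • q = q) ∧
      (∀ q : LevelPath l (n + 1), (∀ v v', Commute (sec (φ v) q) (sec (φ v') q)) →
        sec (φ w) q = 1) ∧ ∀ p ∈ s, ∀ x, sec (φ w) (snoc p x) = 1 := by
    intro s
    induction s using Finset.induction_on with
    | empty => exact ⟨w₀, hw₀1, by simpa using hw₀S, hw₀t, hw₀c, by simp⟩
    | @insert p s hp ih =>
      obtain ⟨w, hw1, hwS, hwt, hwc, hws⟩ := ih
      have hle : s.card + 1 ≤ m := by
        rw [← hcard, ← Finset.card_insert_of_notMem hp]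
        exact Finset.card_le_univ _
      rw [Finset.card_insert_of_notMem hp]
      set K := (56 * (m * L)) ^ s.card * (20 * (m * L)) with hK
      have hK' : (56 * (m * L)) ^ (s.card + 1) * (20 * (m * L)) = 56 * (m * L) * K := by
        rw [hK, pow_succ]; ring
      have hK20 : 20 * (m * L) ≤ K := Nat.le_mul_of_pos_left _ (by positivity)
      have hKl : 56 * (m * L) * K ≤ l n := by
        calc 56 * (m * L) * K = (56 * (m * L)) ^ (s.card + 1) * (20 * (m * L)) := hK'.symm
          _ ≤ (56 * (m * L)) ^ m * (56 * (m * L)) :=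
            Nat.mul_le_mul (Nat.pow_le_pow_right (by omega) hle) (by omega)
          _ = (56 * (m * L)) ^ (m + 1) := (pow_succ _ _).symm
          _ ≤ l n := hln
      rw [hK']
      rcases hdich p with ⟨u₀, hu₀p, x₀, hx₀⟩ | hcomm
      · obtain ⟨u, huS, hup, x, hux⟩ := exists_spread_loop φ hl0 hL hu₀p hx₀
        have hU : (2 * m + 1) * L ≤ 3 * (m * L) := by
          have : L ≤ m * L := Nat.le_mul_of_pos_left L hm
          rw [add_mul, mul_assoc]; omega
        have hKK : K ≤ m * L * K := Nat.le_mul_of_pos_left K hmL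
        -- With `Y = mL`, `U = 3mL` and `K ≥ 20mL`, the shift is at most `12mLK + K ≤ 13mLK = T`.
        -- The new spread `4K + 4T` is then at most `56mLK`, the origin of the constant 56.
        obtain ⟨w', h1, h2, h3, h4, h5⟩ := exists_commutator_sec_eq_one φ hw1 hwS hwt
          (huS.mono hU) hup hux (hyS 0) (hy 0 p) (hyS 1) (hy 1 p) hyy
          (T := 13 * (m * L * K)) (by
            calc (2 * K + 3 + m * L) * (3 * (m * L)) + m * L
                ≤ (4 * K) * (3 * (m * L)) + K :=
                  add_le_add (Nat.mul_le_mul_right _ (by omega)) (by omega)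
              _ = 12 * (m * L * K) + K := by ring
              _ ≤ 13 * (m * L * K) := by omega)
          (by rw [mul_assoc 56] at hKl; omega)
        refine ⟨w', h1, h2.mono (by rw [mul_assoc 56]; omega), h3,
          fun q hq => h4 q (hwc q hq), fun p' hp' x => ?_⟩
        rcases Finset.mem_insert.1 hp' with rfl | hp'
        · exact h5 x
        · exact h4 _ (hws p' hp' x)
      · refine ⟨w, hw1, hwS.mono (Nat.le_mul_of_pos_left K (by omega)), hwt, hwc,
          fun p' hp' x => ?_⟩
        rcases Finset.mem_insert.1 hp' with rfl | hp'
        · exact hwc _ (hcomm x)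
        · exact hws p' hp' x
  obtain ⟨w, hw1, -, hwt, -, hw⟩ := key Finset.univ
  refine ⟨w, hw1, eq_one_of_forall_sec (n + 1) hwt fun q => ?_⟩
  cases q with
  | snoc p x => exact hw p (Finset.mem_univ p) x

/-- Any two elements of the spinal group satisfy a nontrivial relation. -/
theorem exists_relation (hl : ∀ i, 7 ≤ l i)
    (hgrowth : ∀ i, 1 ≤ i → (25 * l (i - 1)) ^ (3 * ∏ j ∈ Finset.range i, l j) ≤ l i)
    (g₁ g₂ : spinalGroup l) :
    ∃ w : FreeGroup (Fin 2), w ≠ 1 ∧ FreeGroup.lift ![g₁, g₂] w = 1 := by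
  have hl0 : ∀ i, l i ≠ 0 := fun i => by linarith [hl i]
  let ι := Subgroup.inclusion (spinalGroup_le_sectionGroup (l := l))
  let ψ := FreeGroup.lift ![g₁, g₂]
  let φ : FreeGroup (Fin 2) →* sectionGroup l := ι.comp ψ
  have hφ : ∀ w n, ∃ K, Spread n K (φ w) := fun w n => exists_spread (ψ w).2 n
  obtain ⟨n₀, L, hL1, hsmall⟩ : ∃ n₀ L, 1 ≤ L ∧
      ∀ j, SmallSections n₀ L (φ (FreeGroup.of j)) := by
    obtain ⟨n, K, h⟩ := exists_smallSections _ (ψ (FreeGroup.of 0)).2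
    obtain ⟨n', K', h'⟩ := exists_smallSections _ (ψ (FreeGroup.of 1)).2
    refine ⟨max n n', max K K' + 1, by omega, fun j => ?_⟩
    fin_cases j
    · exact (h.mono_level (le_max_left _ _)).mono (by omega)
    · exact (h'.mono_level (le_max_right _ _)).mono (by omega)
  have hrange : Subgroup.closure (Set.range fun j => φ (FreeGroup.of j)) = φ.range := by
    rw [MonoidHom.range_eq_map, ← FreeGroup.closure_range_of, MonoidHom.map_closure,
      ← Set.range_comp]
    rfl
  obtain ⟨n₁, hn₁⟩ := exists_moves_child_or_commute hl0
    (T := Set.range fun j => φ (FreeGroup.of j)) (n₀ := n₀) (K := L)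
    (by rintro _ ⟨j, rfl⟩; exact hsmall j)
  rw [hrange] at hn₁
  -- `L` and the thresholds `n₀`, `n₁` are fixed before `n`, so the growth condition can be applied
  -- beyond both.
  obtain ⟨n, hn, hln⟩ := exists_pow_le_of_growth hl hgrowth L (max n₀ n₁)
  obtain ⟨w, hw1, hw⟩ := exists_ne_one_map_eq_one φ hl0 hL1
    (fun j => Spread.of_smallSections ((hsmall j).mono_level ((le_max_left _ _).trans hn)))
    (fun j p => by rw [map_pow]; exact pow_prod_smul (hφ _) n p)
    (fun p => by
      rcases hn₁ n ((le_max_right _ _).trans hn) p with ⟨_, ⟨u, rfl⟩, h⟩ | h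
      · exact Or.inl ⟨u, h⟩
      · exact Or.inr fun x v v' => h x _ ⟨v, rfl⟩ _ ⟨v', rfl⟩) hln
  exact ⟨w, hw1, Subgroup.inclusion_injective spinalGroup_le_sectionGroup
    (hw.trans (map_one ι).symm)⟩

end Law

theorem mainTheorem1 (l : ℕ → ℕ) (hl : ∀ i, 7 ≤ l i)
    (hcop : ∀ i j, i ≠ j → Nat.Coprime (l i) (l j))
    (hgrowth : ∀ i, 1 ≤ i →
      (25 * l (i - 1)) ^ (3 * ∏ j ∈ Finset.range i, l j) ≤ l i) :
    (∀ H : Subgroup (spinalGroup l), ¬ Nonempty (H ≃* FreeGroup (Fin 2))) ∧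
    (∀ g₁ g₂ : spinalGroup l,
      ∃ w : FreeGroup (Fin 2), w ≠ 1 ∧ FreeGroup.lift ![g₁, g₂] w = 1) := by
  refine ⟨?_, exists_relation hl hgrowth⟩
  rintro H ⟨e⟩
  let f : FreeGroup (Fin 2) →* spinalGroup l := H.subtype.comp e.symm.toMonoidHom
  obtain ⟨w, hw1, hw⟩ := exists_relation hl hgrowth (f (FreeGroup.of 0)) (f (FreeGroup.of 1))
  have hf : FreeGroup.lift ![f (FreeGroup.of 0), f (FreeGroup.of 1)] = f := by
    ext j
    fin_cases j <;> simp
  rw [hf] at hw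
  exact hw1 ((map_eq_one_iff f (H.subtype_injective.comp e.symm.injective)).1 hw)
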